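/- Let $n,k\ge 1$. A reflexive voltage tree $(T,\sigma)$ over $\mathbb Z_n$ is a finite tree $T$ to which exactly one loop has been added at every vertex, together with voltages $\sigma(u,v)=-\sigma(v,u)\in\mathbb Z_n$ on the two arcs of each non-loop edge and voltages $\sigma(v),-\sigma(v)$ on the primary and secondary arc of the loop at each vertex $v$. The covering graph $T^\sigma$ has vertex set $V(T)\times\mathbb Z_n$, and $(u,a)$, $(v,b)$ are adjacent iff some arc from $u$ to $v$ has voltage $b-a$. The fibre over $v$ is $\{v\}\times\mathbb Z_n$. For a path $Q=(v_1,\dots,v_m)$ in $T$, $m\ge 2$, let $c(Q)=\left\lceil \tfrac12\max\{\gcd(n,\sigma(v_t)):2\le t\le m-1\}\right\rceil$ if $m\ge 3$, and $c(Q)=1$ if $m=2$. Suppose $\sigma(v_1)=\sigma(v_m)=r$, put $d=2c(Q)$, and suppose that $0,r,\dots,(d-1)r$ are distinct in $\mathbb Z_n$. Define paths $P_0,\dots,P_{d-1}$ in $T^\sigma$ as follows. The path $P_j$ starts at $(v_1,jr)$ and makes no step inside the fibre over $v_1$. Having arrived at $(v_t,x)$, where $2\le t\le m-1$, it follows $(v_t,x+\sigma(v_t)),(v_t,x+2\sigma(v_t)),\dots$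 and stops just before the first of these vertices at which some $P_i$ (possibly $i=j$) arrives in the fibre over $v_t$. From a stopping element $y$ in the fibre over $v_t$ (for $t=1$: the starting element), $1\le t\le m-1$, it goes to $(v_{t+1},y+\sigma(v_t,v_{t+1}))$. For $1\le t\le m-1$ the paths leave the fibre over $v_t$ from the elements $\alpha_t,\alpha_t+r,\dots,\alpha_t+(d-1)r$, where $\alpha_1=0$ and $\alpha_t=\alpha_{t-1}+\sigma(v_{t-1},v_t)-\sigma(v_t)$ for $t\ge 2$; if $P_{a_1},\dots,P_{a_d}$, respectively, leave from these elements, then $(a_1,\dots,a_d)$ is the order of the paths at $v_t$. The path $Q$ is an odd shifting path with endpoint voltage $r$ if the order at $v_{m-1}$ is $(d-s,d-s+1,\dots,d-1,0,1,\dots,d-s-1)$ for some odd $s$ with $0<s<d$. An odd shifting decomposition of $(T,\sigma)$ is a family $Q_1,\dots,Q_k$ of odd shifting paths in $T$ such that every non-loop edge of $T$ lies in exactly one $Q_i$ and, for $i\ne j$, every vertex common to $Q_i$ and $Q_j$ is an endpoint of both. (Then all $Q_i$ have the same endpoint voltage.) A joint is an endpoint of some $Q_i$. The tree is properly weighted if,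 for every joint $v$, the sum of $2c(Q_i)$ over all $i$ such that $v$ is an endpoint of $Q_i$ is at most $n$. **Theorem.** Let $(T,\sigma)$ be a reflexive voltage tree over $\mathbb Z_n$ with an odd shifting decomposition $Q_1,\dots,Q_k$, $k\ge 1$, whose common endpoint voltage is coprime to $n$. If $(T,\sigma)$ is properly weighted, then $T^\sigma$ is Hamiltonian. -/

import Mathlib

/-- A reflexive voltage graph over `ℤ_n`: the graph obtained by deleting the loops is the simple
graph `graph`, and there is exactly one loop at every vertex.
`edge u v` is the voltage of the arc `(u, v)` (its values on non-adjacent pairs are irrelevant).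
`loop v` is the voltage of the primary loop arc at `v`; the secondary loop arc at `v` has
voltage `-loop v`. -/
structure ReflexiveVoltageGraph (V : Type*) (n : ℕ) where
  graph : SimpleGraph V
  edge : V → V → ZMod n
  edge_symm : ∀ u v, graph.Adj u v → edge v u = -edge u v
  loop : V → ZMod n

namespace ReflexiveVoltageGraph

variable {V : Type*} {n : ℕ} (Γ : ReflexiveVoltageGraph V n)

/-- The covering graph: `(u, a)` and `(v, b)` are adjacent iff some arc from `u` to `v` has
voltage `b - a`. (A loop of voltage `0` would only produce loops of the covering graph; these
are dropped, as they play no role for Hamiltonian cycles.) -/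
def cover : SimpleGraph (V × ZMod n) where
  Adj x y := x ≠ y ∧
    ((Γ.graph.Adj x.1 y.1 ∧ Γ.edge x.1 y.1 = y.2 - x.2) ∨
      (x.1 = y.1 ∧ (Γ.loop x.1 = y.2 - x.2 ∨ -Γ.loop x.1 = y.2 - x.2)))
  symm := ⟨by
    rintro x y ⟨hne, h⟩
    refine ⟨hne.symm, ?_⟩
    rcases h with ⟨hadj, he⟩ | ⟨hv, he | he⟩
    · exact Or.inl ⟨hadj.symm, by rw [Γ.edge_symm _ _ hadj, he, neg_sub]⟩
    · exact Or.inr ⟨hv.symm, Or.inr (by rw [← hv, he, neg_sub])⟩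
    · exact Or.inr ⟨hv.symm, Or.inl (by rw [← hv, ← neg_neg (Γ.loop x.1), he, neg_sub])⟩⟩
  loopless := ⟨fun _ h => h.1 rfl⟩

/-- One fibre of the extended billiard strategy. A path that has arrived at `x` in a fibre with
loop voltage `a` follows `x + a, x + 2a, …` and stops at the first vertex `x + s a` for which
`x + (s + 1) a` is a vertex of `S`, the set of vertices at which the paths arrive in the fibre.
The value is the vertex at which the path stops (it is `x` itself when `a = 0`). -/
noncomputable def fibreExit (a : ZMod n) (S : Set (ZMod n)) (x : ZMod n) : ZMod n :=
  x + sInf {s : ℕ | x + (s + 1) • a ∈ S} • a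

variable {u v : V} (p : Γ.graph.Walk u v)

/-- If the paths `P_0, …, P_{d-1}` arrive in the fibre over the `t`-th vertex of `p` (counted
from `0`) at the elements `f 0, …, f (d - 1)`, then `P_j` leaves that fibre from
`billiardExit p d t f j`. In the fibre over the first vertex the paths make no steps. -/
noncomputable def billiardExit (d t : ℕ) (f : ℕ → ZMod n) (j : ℕ) : ZMod n :=
  if t = 0 then f j
  else fibreExit (Γ.loop (p.getVert t)) {x | ∃ k < d, x = f k} (f j)

/-- The extended billiard strategy with `d` paths along `p`: `billiardArrive p d t j` is the
element at which `P_j` arrives in the fibre over the `t`-th vertex of `p`. The path `P_j` starts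
in the fibre over the first vertex at `j r`, where `r` is the loop voltage of that vertex. -/
noncomputable def billiardArrive (d : ℕ) : ℕ → ℕ → ZMod n
  | 0 => fun j => j • Γ.loop u
  | t + 1 => fun j =>
      Γ.billiardExit p d t (billiardArrive d t) j + Γ.edge (p.getVert t) (p.getVert (t + 1))

/-- The element from which `P_j` leaves the fibre over the `t`-th vertex of `p`. -/
noncomputable def billiardDepart (d t j : ℕ) : ZMod n :=
  Γ.billiardExit p d t (Γ.billiardArrive p d t) j

/-- The element `i_t`: the paths arrive in the fibre over the `t`-th vertex of `p` at the
elements `i_t, i_t + r, …, i_t + (d - 1) r`. -/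
def arriveBase : ℕ → ZMod n
  | 0 => 0
  | t + 1 => (if t = 0 then arriveBase t else arriveBase t - Γ.loop (p.getVert t)) +
      Γ.edge (p.getVert t) (p.getVert (t + 1))

/-- The element `α_t`: the paths leave the fibre over the `t`-th vertex of `p` from the
elements `α_t, α_t + r, …, α_t + (d - 1) r`. -/
def departBase (t : ℕ) : ZMod n :=
  if t = 0 then Γ.arriveBase p t else Γ.arriveBase p t - Γ.loop (p.getVert t)

/-- The paths `P_0, …, P_{d-1}` have order `π` at the `t`-th vertex of `p`: for each `k < d`, the
path that leaves the fibre from `α_t + k r` is `P_{π k}`. -/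
def HasOrder (d t : ℕ) (π : ℕ → ℕ) : Prop :=
  ∀ k < d, Γ.billiardDepart p d t (π k) = Γ.departBase p t + k • Γ.loop u

/-- The invariant `c`: half the maximum of `gcd(n, σ(v))` over the internal vertices `v` of `p`,
rounded up, and `1` if `p` has no internal vertex. -/
def pathC : ℕ :=
  if p.length ≤ 1 then 1
  else ((Finset.Ioo 0 p.length).sup (fun t => Nat.gcd n (Γ.loop (p.getVert t)).val) + 1) / 2

/-- `p = (v_1, …, v_m)` is an odd shifting path: the loop voltages `r` at its two ends agree,
`d = 2 c` paths can be started at the distinct elements `0, r, …, (d - 1) r`, and the order of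
these paths at `v_{m-1}` is `(d - s, …, d - 1, 0, 1, …, d - s - 1)` for an odd `s` with
`0 < s < d`. -/
def IsOddShifting : Prop :=
  Γ.loop u = Γ.loop v ∧ 2 * Γ.pathC p ≤ addOrderOf (Γ.loop u) ∧
    ∃ s : ℕ, Odd s ∧ 0 < s ∧ s < 2 * Γ.pathC p ∧
      Γ.HasOrder p (2 * Γ.pathC p) (p.length - 1)
        (fun k => if k < s then 2 * Γ.pathC p - s + k else k - s)

variable {k : ℕ} {src tgt : Fin k → V} (Q : ∀ i, Γ.graph.Path (src i) (tgt i))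

/-- `Q_1, …, Q_k` is an odd shifting decomposition: every `Q_i` is an odd shifting path, the
non-loop edges are partitioned by the `Q_i`, and every common vertex of two different paths is
an endpoint of both. -/
structure IsOddShiftingDecomposition : Prop where
  oddShifting : ∀ i, Γ.IsOddShifting (Q i).1
  partition : ∀ e ∈ Γ.graph.edgeSet, ∃! i, e ∈ (Q i).1.edges
  disjoint : ∀ i j, i ≠ j → ∀ w, w ∈ (Q i).1.support → w ∈ (Q j).1.support →
    (w = src i ∨ w = tgt i) ∧ (w = src j ∨ w = tgt j)

/-- The tree weight of `w`: the sum of `2 c(Q_i)` over all `i` such that `w` is an endpoint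
of `Q_i`. -/
def treeWeight [DecidableEq V] (w : V) : ℕ :=
  ∑ i : Fin k, if w = src i ∨ w = tgt i then 2 * Γ.pathC (Q i).1 else 0

/-- The tree weight of every joint (endpoint of some `Q_i`) is at most `n`. -/
def IsProperlyWeighted [DecidableEq V] : Prop :=
  ∀ w, (∃ i, w = src i ∨ w = tgt i) → Γ.treeWeight Q w ≤ n

end ReflexiveVoltageGraph

/-! The Hamiltonian cycle is grown over `T`, one path `Q_j` at a time. Let `r` be the endpoint
voltage. As `r` is a unit, the loop at a joint turns its fibre into a single cycle; one such fibre
is the start.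

Along `Q_j`, from `u` to `v`, the `d = 2c` billiard paths partition the interior fibres. At each
internal vertex the arrival elements form a progression of `d` terms with difference `r`. Since `d`
is at least the gcd of `n` with the loop voltage, this progression meets every coset of the subgroup
generated by that voltage, so every element lies on the stretch of exactly one path. The exit set is
the arrival set moved back by the loop voltage, hence again such a progression
(`IsProgressionOn.fibreExit`). In the fibre over `v`, `P_j` arrives at position `j + s` modulo `d`
(`IsOddShifting.isBridge`).

To attach `v` to a cycle through the fibre over `u`, remove the loop steps from position `2i` to `2i
+ 1` of a block of `d` consecutive elements. Replace each by `P_{2i}`, a stretch of loop steps over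
`v`, and `P_{2i+1}` reversed. As `s` is odd, `P_{2i}` arrives at an odd position and `P_{2i+1}` at
the next one cyclically. The stretches over `v` join positions 1 to 2, 3 to 4, and so on; the last
runs from `d - 1` around the rest of the fibre to 0. Together they cover the fibre over `v` once
(`IsBridge.exists_detours`).

Outside a block of `d` elements, the new fibre is still traversed by primary loop steps. Each joint
therefore reserves disjoint blocks for its incident paths, which proper weighting makes possible.
`StepRel` records where loop steps are guaranteed. Connectedness always supplies a further path to
attach, and acyclicity ensures that its far end is new. -/

/-! ### Cyclic sequences and Hamiltonicity. -/

/-- The elements of `S` can be arranged into a cyclic sequence without repetitions in which any two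
consecutive elements are related by `R`. -/
def CyclicOn {X : Type*} (R : X → X → Prop) (S : Set X) : Prop :=
  ∃ (x : X) (t : List X), (x :: t).Nodup ∧ List.IsChain R (x :: t ++ [x]) ∧ ∀ y, y ∈ x :: t ↔ y ∈ S

theorem List.isChain_flatMap_insert {X : Type*} {R R' : X → X → Prop} {g : X → List X}
    (h : ∀ a b, R a b → List.IsChain R' (a :: g a ++ [b])) :
    ∀ (l : List X) (b : X), List.IsChain R (l ++ [b]) →
      List.IsChain R' (l.flatMap (fun a => a :: g a) ++ [b])
  | [], b, _ => by simp
  | [a], b, hl => by simpa using h a b (by simpa using hl)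
  | a :: a' :: l, b, hl => by
    have hl' : R a a' ∧ List.IsChain R (a' :: l ++ [b]) := by simpa using hl
    have ih := List.isChain_flatMap_insert h (a' :: l) b hl'.2
    have h1 := h a a' hl'.1
    simp only [List.flatMap_cons, List.cons_append, List.append_assoc] at ih h1 ⊢
    exact List.isChain_cons_split.2 ⟨h1, ih⟩

/-- Inserting the list `w i` right after `tail i` into a cyclic sequence, for all `i`. -/
theorem CyclicOn.insert {X ι : Type*} {R R' : X → X → Prop} {S : Set X} {tail : ι → X}
    {w : ι → List X} (hS : CyclicOn R S) (hinj : Function.Injective tail)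
    (hmem : ∀ i, tail i ∈ S) (hnodup : ∀ i, (w i).Nodup)
    (hdisj : ∀ i j, i ≠ j → ∀ y ∈ w i, y ∉ w j) (hdisjS : ∀ i, ∀ y ∈ w i, y ∉ S)
    (hold : ∀ a b, R a b → R' a b)
    (hnew : ∀ i b, R (tail i) b → List.IsChain R' (tail i :: w i ++ [b])) :
    CyclicOn R' (S ∪ {y | ∃ i, y ∈ w i}) := by
  classical
  obtain ⟨x, t, hnd, hch, hm⟩ := hS
  set g : X → List X := Function.extend tail w (fun _ => []) with hg
  have g_tail : ∀ i, g (tail i) = w i := fun i => hinj.extend_apply w _ i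
  have g_other : ∀ a, (¬ ∃ i, tail i = a) → g a = [] := fun a ha => Function.extend_apply' w _ a ha
  have mem_g : ∀ a y, y ∈ g a → ∃ i, tail i = a ∧ y ∈ w i := by
    intro a y hy
    by_cases ha : ∃ i, tail i = a
    · obtain ⟨i, rfl⟩ := ha
      exact ⟨i, rfl, by rwa [g_tail] at hy⟩
    · rw [g_other a ha] at hy
      simp at hy
  refine ⟨x, g x ++ t.flatMap (fun a => a :: g a), ?_, ?_, ?_⟩
  · change ((x :: t).flatMap (fun a => a :: g a)).Nodup
    rw [List.nodup_flatMap]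
    constructor
    · intro a ha
      rw [List.nodup_cons]
      constructor
      · intro h
        obtain ⟨i, -, hi⟩ := mem_g _ _ h
        exact hdisjS i a hi ((hm a).1 ha)
      · by_cases ha : ∃ i, tail i = a
        · obtain ⟨i, rfl⟩ := ha
          rw [g_tail]; exact hnodup i
        · rw [g_other a ha]; simp
    · refine List.Pairwise.imp_of_mem ?_ hnd
      intro a b ha hb hab
      simp only [Function.onFun, List.disjoint_left, List.mem_cons]
      rintro y (rfl | hy) (rfl | hy')
      · exact hab rfl
      · obtain ⟨i, -, hi⟩ := mem_g _ _ hy'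
        exact hdisjS i _ hi ((hm _).1 ha)
      · obtain ⟨i, -, hi⟩ := mem_g _ _ hy
        exact hdisjS i _ hi ((hm _).1 hb)
      · obtain ⟨i, hia, hi⟩ := mem_g _ _ hy
        obtain ⟨j, hjb, hj⟩ := mem_g _ _ hy'
        refine hdisj i j ?_ y hi hj
        rintro rfl
        exact hab (hia.symm.trans hjb)
  · have := List.isChain_flatMap_insert (R := R) (R' := R') (g := g) ?_ (x :: t) x hch
    · simpa using this
    · intro a b hab
      by_cases ha : ∃ i, tail i = a
      · obtain ⟨i, rfl⟩ := ha
        rw [g_tail]; exact hnew i b hab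
      · rw [g_other a ha]; simpa using hold a b hab
  · intro y
    change y ∈ (x :: t).flatMap (fun a => a :: g a) ↔ _
    rw [List.mem_flatMap]
    constructor
    · rintro ⟨a, ha, hy⟩
      rcases List.mem_cons.1 hy with rfl | hy
      · exact Or.inl ((hm _).1 ha)
      · obtain ⟨i, -, hi⟩ := mem_g _ _ hy
        exact Or.inr ⟨i, hi⟩
    · rintro (hy | ⟨i, hi⟩)
      · exact ⟨y, (hm y).2 hy, by simp⟩
      · exact ⟨tail i, (hm _).2 (hmem i), by rw [g_tail]; simp [hi]⟩

theorem CyclicOn.mono {X : Type*} {R R' : X → X → Prop} {S : Set X} (hS : CyclicOn R S)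
    (h : ∀ a b, R a b → R' a b) : CyclicOn R' S := by
  obtain ⟨x, t, hnd, hch, hm⟩ := hS
  exact ⟨x, t, hnd, hch.imp h, hm⟩

theorem SimpleGraph.Walk.exists_support_eq {X : Type*} {G : SimpleGraph X} {l : List X} {x y : X}
    (hl : List.IsChain G.Adj l) (hne : l ≠ []) (hx : l.head hne = x) (hy : l.getLast hne = y) :
    ∃ p : G.Walk x y, p.support = l := by
  subst hx hy
  exact ⟨SimpleGraph.Walk.ofSupport l hne hl, SimpleGraph.Walk.support_ofSupport hne hl⟩

theorem SimpleGraph.isHamiltonian_of_cyclicOn {X : Type*} [Fintype X] [DecidableEq X]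
    {G : SimpleGraph X} (hcard : 3 ≤ Fintype.card X) (h : CyclicOn G.Adj Set.univ) :
    G.IsHamiltonian := by
  obtain ⟨x, t, hnd, hch, hm⟩ := h
  have hlen : (x :: t).length = Fintype.card X := by
    rw [← List.toFinset_card_of_nodup hnd, Finset.eq_univ_of_forall (s := (x :: t).toFinset)
      (by simpa using hm)]
    rfl
  match t, hlen, hnd, hch, hm with
  | [], hlen, _, _, _ => simp at hlen; omega
  | [y], hlen, _, _, _ => simp at hlen; omega
  | y :: z :: t, hlen, hnd, hch, hm =>
    intro _
    have hxy : G.Adj x y := by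
      simp only [List.cons_append, List.isChain_cons_cons] at hch
      exact hch.1
    have hch' : List.IsChain G.Adj (y :: z :: t ++ [x]) := by
      simp only [List.cons_append, List.isChain_cons_cons] at hch ⊢
      exact hch.2
    obtain ⟨p, hp⟩ := SimpleGraph.Walk.exists_support_eq (x := y) (y := x) hch' (by simp) rfl (by simp)
    have hperm : (y :: z :: t ++ [x]).Perm (x :: y :: z :: t) := List.perm_append_singleton _ _
    have hpath : p.IsPath := by
      rw [SimpleGraph.Walk.isPath_def, hp]
      exact hperm.nodup_iff.2 hnd
    refine ⟨x, SimpleGraph.Walk.cons hxy p, ?_⟩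
    rw [SimpleGraph.Walk.isHamiltonianCycle_iff_isCycle_and_length_eq,
      SimpleGraph.Walk.cons_isCycle_iff]
    refine ⟨⟨hpath, ?_⟩, ?_⟩
    -- The closing edge `{x, y}` could lie on the path from `y` only as its first edge, because `y`
    -- is not visited again. The second vertex of that path would then be `x`, contradicting
    -- distinctness.
    · generalize p = q at hp hpath
      cases q with
      | nil => exact fun _ => hxy.ne rfl
      | @cons _ z' _ h q =>
        have hz : z' = z := by
          rw [SimpleGraph.Walk.support_cons, ← SimpleGraph.Walk.cons_tail_support] at hp
          simp only [List.cons_append, List.cons.injEq] at hp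
          exact hp.2.1
        subst hz
        have hy := (SimpleGraph.Walk.cons_isPath_iff _ _).1 hpath
        intro hmem
        rw [SimpleGraph.Walk.edges_cons, List.mem_cons] at hmem
        rcases hmem with he | he
        · have hxz : x = z' := by
            rw [Sym2.eq_iff] at he
            rcases he with ⟨h1, -⟩ | ⟨h1, -⟩
            · exact absurd h1 hxy.ne
            · exact h1
          subst hxz
          simp at hnd
        · exact hy.2 (SimpleGraph.Walk.snd_mem_support_of_mem_edges _ he)
    · have := congrArg List.length hp
      rw [SimpleGraph.Walk.length_support] at this
      simp at this hlen ⊢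
      omega

/-! ### Stretches and progressions in one fibre. -/

/-- The vertices `(v, x), (v, x + a), …, (v, x + e a)`. -/
def fibreOrbit {V : Type*} {n : ℕ} (v : V) (x a : ZMod n) (e : ℕ) : List (V × ZMod n) :=
  (List.range (e + 1)).map fun s => (v, x + s • a)

section FibreOrbit

variable {V : Type*} {n : ℕ} {v : V} {x a : ZMod n} {e : ℕ}

theorem fibreOrbit_eq_cons : fibreOrbit v x a e =
    (v, x) :: (List.range e).map fun s => (v, x + (s + 1) • a) := by
  simp [fibreOrbit, List.range_succ_eq_map, Function.comp_def]

theorem mem_fibreOrbit {y : V × ZMod n} :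
    y ∈ fibreOrbit v x a e ↔ ∃ s ≤ e, y = (v, x + s • a) := by
  simp [fibreOrbit, eq_comm]

theorem nodup_fibreOrbit (h : ∀ s ≤ e, ∀ s' ≤ e, x + s • a = x + s' • a → s = s') :
    (fibreOrbit v x a e).Nodup := by
  refine List.Nodup.map_on ?_ List.nodup_range
  intro s hs s' hs' hss
  simp only [List.mem_range, Nat.lt_succ_iff] at hs hs'
  exact h s hs s' hs' (Prod.ext_iff.1 hss).2

theorem isChain_fibreOrbit {R : V × ZMod n → V × ZMod n → Prop} {y : V × ZMod n}
    (h : ∀ s < e, R (v, x + s • a) (v, x + (s + 1) • a)) (hy : R (v, x + e • a) y) :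
    List.IsChain R (fibreOrbit v x a e ++ [y]) := by
  rw [List.isChain_append]
  refine ⟨?_, by simp, ?_⟩
  · rw [fibreOrbit, List.isChain_map, List.isChain_range_succ]
    exact h
  · intro z hz y' hy'
    simp only [fibreOrbit, List.range_succ, List.map_append, List.map_cons, List.map_nil,
      List.getLast?_append, List.getLast?_singleton, Option.some_or, Option.mem_def,
      Option.some.injEq, List.head?_cons] at hz hy'
    subst hz hy'
    exact hy

end FibreOrbit

section Progressions

variable {n : ℕ} {a x x' y : ZMod n} {S : Set (ZMod n)}

/-- The elements `f 0, …, f (d - 1)` are distinct, and they are `b, b + r, …, b + (d - 1) r` for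
some `b`, in some order. -/
def IsProgressionOn (d : ℕ) (r : ZMod n) (f : ℕ → ZMod n) : Prop :=
  (∀ i < d, ∀ j < d, f i = f j → i = j) ∧
    ∃ b, ∀ x, (∃ k < d, x = f k) ↔ ∃ k < d, x = b + k • r

theorem IsProgressionOn.add_const {d : ℕ} {r : ZMod n} {f : ℕ → ZMod n}
    (hf : IsProgressionOn d r f) (c : ZMod n) : IsProgressionOn d r (fun j => f j + c) := by
  obtain ⟨hinj, b, hb⟩ := hf
  refine ⟨fun i hi j hj h => hinj i hi j hj (add_right_cancel h), b + c, fun x => ?_⟩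
  have := hb (x - c)
  simp only [sub_eq_iff_eq_add] at this
  rw [this]
  simp only [add_right_comm]

/-- The number of steps taken in a fibre by a path arriving at `x`. -/
noncomputable def fibreSteps (a : ZMod n) (S : Set (ZMod n)) (x : ZMod n) : ℕ :=
  sInf {s : ℕ | x + (s + 1) • a ∈ S}

theorem fibreExit_eq : ReflexiveVoltageGraph.fibreExit a S x = x + fibreSteps a S x • a := rfl

theorem notMem_of_lt_fibreSteps {s : ℕ} (h : s < fibreSteps a S x) : x + (s + 1) • a ∉ S :=
  Nat.notMem_of_lt_sInf h

/-- Stretches from different arrival elements are disjoint: if two met, one arrival element would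
lie in the middle of the other stretch, which should have stopped before it. -/
theorem eq_of_fibreSteps_le (hx : x ∈ S) (hx' : x' ∈ S) {s s' : ℕ} (hs : s ≤ fibreSteps a S x)
    (hs' : s' ≤ fibreSteps a S x') (h : x + s • a = x' + s' • a) : x = x' ∧ s = s' := by
  wlog hle : s ≤ s' generalizing x x' s s'
  · obtain ⟨h1, h2⟩ := this hx' hx hs' hs h.symm (by omega)
    exact ⟨h1.symm, h2.symm⟩
  obtain ⟨m, rfl⟩ := Nat.exists_eq_add_of_le hle
  have hxx : x = x' + m • a := by
    rw [add_nsmul] at h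
    linear_combination h
  cases m with
  | zero => exact ⟨by simpa using hxx, rfl⟩
  | succ m => exact absurd (hxx ▸ hx) (notMem_of_lt_fibreSteps (by omega))

variable [NeZero n]

theorem nsmul_left_inj_of_coprime {r : ZMod n} (hr : Nat.Coprime r.val n) {i j : ℕ} (hi : i < n)
    (hj : j < n) (h : i • r = j • r) : i = j := by
  have hu : IsUnit r := by
    rw [← ZMod.natCast_zmod_val r]
    exact (ZMod.isUnit_iff_coprime _ _).2 hr
  rw [nsmul_eq_mul, nsmul_eq_mul] at h
  have h' := hu.mul_right_cancel h
  rw [ZMod.natCast_eq_natCast_iff'] at h'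
  rwa [Nat.mod_eq_of_lt hi, Nat.mod_eq_of_lt hj] at h'

/-- Any `d ≥ gcd (n, a)` consecutive multiples of a unit `r` meet every coset of `⟨a⟩`. -/
theorem exists_sub_nsmul_eq_add_nsmul {r a : ZMod n} (hr : Nat.Coprime r.val n) {d : ℕ}
    (hd : Nat.gcd n a.val ≤ d) (base y : ZMod n) :
    ∃ m : ℕ, ∃ k < d, y - m • a = base + k • r := by
  have hu : IsUnit r := by
    rw [← ZMod.natCast_zmod_val r]
    exact (ZMod.isUnit_iff_coprime _ _).2 hr
  obtain ⟨u, hu'⟩ := hu.exists_left_inv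
  set g := Nat.gcd n a.val with hg
  have gpos : 0 < g := Nat.gcd_pos_of_pos_left _ (NeZero.pos n)
  have bez : (g : ZMod n) = a * (Nat.gcdB n a.val : ℤ) := by
    have := congrArg (Int.cast : ℤ → ZMod n) (Nat.gcd_eq_gcd_ab n a.val)
    push_cast at this
    rw [← hg] at this
    simpa using this
  set k := ((y - base) * u).val with hk
  -- Write `y - base = k r` and reduce `k` modulo `g`. The remaining multiple of `g` is a multiple
  -- of `a` by Bézout.
  refine ⟨(((k / g : ℕ) : ZMod n) * r * ((Nat.gcdB n a.val : ℤ) : ZMod n)).val, k % g,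
    (Nat.mod_lt _ gpos).trans_le hd, ?_⟩
  have hk' : (y - base) * u = ((k % g : ℕ) : ZMod n) + (g : ZMod n) * ((k / g : ℕ) : ZMod n) := by
    rw [← Nat.cast_mul, ← Nat.cast_add, Nat.mod_add_div, hk, ZMod.natCast_zmod_val]
  have hy : y - base = ((k % g : ℕ) + (g : ZMod n) * (k / g : ℕ)) * r := by
    rw [← hk', mul_assoc, hu', mul_one]
  rw [nsmul_eq_mul, nsmul_eq_mul, ZMod.natCast_zmod_val]
  rw [bez] at hy
  linear_combination hy

theorem fibreSteps_mem (hx : x ∈ S) : x + (fibreSteps a S x + 1) • a ∈ S := by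
  have : {s : ℕ | x + (s + 1) • a ∈ S}.Nonempty := by
    -- After `n` steps the path is back at `x`, which is in `S`; so the infimum is attained and is
    -- not a default value.
    refine ⟨n - 1, ?_⟩
    have : n - 1 + 1 = n := Nat.sub_add_cancel (NeZero.pos n)
    rw [Set.mem_ofPred_eq, this, nsmul_eq_mul, ZMod.natCast_self, zero_mul, add_zero]
    exact hx
  exact Nat.sInf_mem this

/-- Go back from `y` to the first arrival element met. The stretch from there reaches `y`: had it
stopped earlier, it would have stopped before an arrival element closer to `y`. -/
theorem exists_eq_add_nsmul_of_le_fibreSteps (h : ∃ m : ℕ, y - m • a ∈ S) :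
    ∃ x ∈ S, ∃ s ≤ fibreSteps a S x, y = x + s • a := by
  classical
  refine ⟨_, Nat.find_spec h, Nat.find h, ?_, by abel⟩
  by_contra hlt
  push Not at hlt
  set m := Nat.find h with hm
  set s := fibreSteps a S (y - m • a) with hs
  refine Nat.find_min h (m := m - (s + 1)) (by omega) ?_
  have h1 : m • a = (m - (s + 1)) • a + (s + 1) • a := by
    rw [← add_nsmul]; congr 1; omega
  have h2 := fibreSteps_mem (a := a) (Nat.find_spec h)
  rw [← hm, ← hs, h1] at h2
  convert h2 using 1
  abel

/-- One fibre of the billiard strategy maps progressions to progressions. -/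
theorem IsProgressionOn.fibreExit {d : ℕ} {r : ZMod n} {f : ℕ → ZMod n}
    (hf : IsProgressionOn d r f) (hr : Nat.Coprime r.val n) (hd : Nat.gcd n a.val ≤ d) :
    IsProgressionOn d r
      (fun j => ReflexiveVoltageGraph.fibreExit a {x | ∃ k < d, x = f k} (f j)) := by
  obtain ⟨hinj, b, hb⟩ := hf
  set A : Set (ZMod n) := {x | ∃ k < d, x = f k} with hA
  have hmem : ∀ j < d, f j ∈ A := fun j hj => ⟨j, hj, rfl⟩
  refine ⟨fun i hi j hj h => hinj i hi j hj
    (eq_of_fibreSteps_le (hmem i hi) (hmem j hj) le_rfl le_rfl h).1, b - a, fun x => ?_⟩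
  -- The exit set is the arrival set translated by `-a`, whichever path leaves from which element.
  have key : (∃ k < d, x = ReflexiveVoltageGraph.fibreExit a A (f k)) ↔ x + a ∈ A := by
    constructor
    · rintro ⟨k, hk, rfl⟩
      have := fibreSteps_mem (a := a) (hmem k hk)
      rwa [add_nsmul, one_nsmul, ← add_assoc] at this
    · intro hx
      obtain ⟨m, k, hk, hm⟩ := exists_sub_nsmul_eq_add_nsmul hr hd b x
      obtain ⟨x', ⟨j, hj, rfl⟩, s, hs, rfl⟩ :=
        exists_eq_add_nsmul_of_le_fibreSteps (S := A) (a := a) (y := x)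
          ⟨m, (hb _).2 ⟨k, hk, hm⟩⟩
      refine ⟨j, hj, ?_⟩
      rcases hs.lt_or_eq with hlt | heq
      · refine absurd ?_ (notMem_of_lt_fibreSteps hlt)
        rwa [add_nsmul, one_nsmul, ← add_assoc]
      · rw [heq]; rfl
  rw [key]
  change (∃ k < d, x + a = f k) ↔ _
  rw [hb]
  simp only [sub_add_eq_add_sub, eq_sub_iff_add_eq]

end Progressions

/-! ### The billiard paths partition the interior fibres. -/

namespace ReflexiveVoltageGraph

section Billiard

variable {V : Type*} {n : ℕ} (Γ : ReflexiveVoltageGraph V n) {u v : V}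
  (p : Γ.graph.Walk u v)

/-- The number of steps of `P_j` in the fibre over the `t`-th vertex of `p`. -/
noncomputable def billiardSteps (d t j : ℕ) : ℕ :=
  fibreSteps (Γ.loop (p.getVert t)) {x | ∃ k < d, x = Γ.billiardArrive p d t k}
    (Γ.billiardArrive p d t j)

/-- The part of the path `P_j`, translated by `z`, in the fibre over the `t`-th vertex of `p`. -/
noncomputable def billiardSegment (d : ℕ) (z : ZMod n) (j t : ℕ) : List (V × ZMod n) :=
  fibreOrbit (p.getVert t) (z + Γ.billiardArrive p d t j) (Γ.loop (p.getVert t))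
    (Γ.billiardSteps p d t j)

/-- The part of the path `P_j`, translated by `z`, in the fibres over the vertices of `p` at the
positions `1, …, t`. -/
noncomputable def billiardPath (d : ℕ) (z : ZMod n) (j t : ℕ) : List (V × ZMod n) :=
  (List.range t).flatMap fun i => Γ.billiardSegment p d z j (i + 1)

variable {Γ p}

theorem mem_billiardPath {d : ℕ} {z : ZMod n} {j t : ℕ} {y : V × ZMod n} :
    y ∈ Γ.billiardPath p d z j t ↔ ∃ i, 0 < i ∧ i ≤ t ∧ ∃ s ≤ Γ.billiardSteps p d i j,
      y = (p.getVert i, z + Γ.billiardArrive p d i j + s • Γ.loop (p.getVert i)) := by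
  simp only [billiardPath, List.mem_flatMap, List.mem_range, billiardSegment, mem_fibreOrbit]
  constructor
  · rintro ⟨i, hi, h⟩
    exact ⟨i + 1, by omega, by omega, h⟩
  · rintro ⟨i, hi, hit, h⟩
    refine ⟨i - 1, by omega, ?_⟩
    rwa [Nat.sub_add_cancel hi]

theorem billiardDepart_eq {d t j : ℕ} (ht : 0 < t) : Γ.billiardDepart p d t j =
    Γ.billiardArrive p d t j + Γ.billiardSteps p d t j • Γ.loop (p.getVert t) := by
  rw [billiardDepart, billiardExit, if_neg ht.ne', fibreExit_eq, billiardSteps]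

theorem cover_adj_edge {t : ℕ} (ht : t < p.length) (x : ZMod n) :
    Γ.cover.Adj (p.getVert t, x)
      (p.getVert (t + 1), x + Γ.edge (p.getVert t) (p.getVert (t + 1))) := by
  have h := p.adj_getVert_succ ht
  exact ⟨fun he => h.ne (Prod.ext_iff.1 he).1, Or.inl ⟨h, by simp⟩⟩

theorem cover_adj_loop {w : V} (hw : Γ.loop w ≠ 0) (x : ZMod n) :
    Γ.cover.Adj (w, x) (w, x + Γ.loop w) :=
  ⟨fun he => hw (by simpa using (Prod.ext_iff.1 he).2), Or.inr ⟨rfl, Or.inl (by simp)⟩⟩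

theorem isChain_billiardSegment {d t j : ℕ} (hj : j < d) (h0 : 0 < t) (ht : t < p.length)
    (z : ZMod n) : List.IsChain Γ.cover.Adj (Γ.billiardSegment p d z j t ++
      [(p.getVert (t + 1), z + Γ.billiardArrive p d (t + 1) j)]) := by
  refine isChain_fibreOrbit ?_ ?_
  · intro s hs
    rw [add_nsmul, one_nsmul, ← add_assoc]
    refine cover_adj_loop ?_ _
    -- With loop voltage 0 the next element is the arrival element itself, so no step is taken.
    intro h
    refine notMem_of_lt_fibreSteps hs ?_
    rw [h, smul_zero, add_zero]
    exact ⟨j, hj, rfl⟩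
  · have := cover_adj_edge ht (z + Γ.billiardDepart p d t j)
    rw [billiardDepart_eq h0, ← add_assoc] at this
    convert this using 2
    change z + (Γ.billiardDepart p d t j + _) = _
    rw [billiardDepart_eq h0]
    abel

theorem isChain_billiardPath {d j : ℕ} (hj : j < d) (z : ZMod n) :
    ∀ t < p.length, List.IsChain Γ.cover.Adj ((u, z + j • Γ.loop u) :: Γ.billiardPath p d z j t ++
      [(p.getVert (t + 1), z + Γ.billiardArrive p d (t + 1) j)])
  | 0, h => by
    have := cover_adj_edge h (z + j • Γ.loop u)
    simpa [billiardPath, billiardArrive, billiardExit, add_assoc] using this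
  | t + 1, h => by
    have ih := isChain_billiardPath hj z t (by omega)
    have hs := isChain_billiardSegment (Γ := Γ) (p := p) hj (Nat.succ_pos t) h z
    rw [billiardPath, List.range_succ, List.flatMap_append, List.flatMap_singleton]
    rw [billiardSegment, fibreOrbit_eq_cons] at hs ⊢
    rw [List.cons_append, List.append_assoc, List.cons_append]
    rw [List.cons_append] at hs
    exact List.isChain_cons_split.2 ⟨ih, hs⟩

theorem nodup_billiardPath {d j : ℕ} (hp : p.IsPath) (hj : j < d) (z : ZMod n) {t : ℕ}
    (ht : t < p.length) : (Γ.billiardPath p d z j t).Nodup := by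
  rw [billiardPath, List.nodup_flatMap]
  constructor
  · intro i _
    refine nodup_fibreOrbit fun s hs s' hs' h => ?_
    refine (eq_of_fibreSteps_le ?_ ?_ hs hs' ?_).2
    · exact ⟨j, hj, rfl⟩
    · exact ⟨j, hj, rfl⟩
    · rw [add_assoc, add_assoc] at h
      exact add_left_cancel h
  · refine List.Pairwise.imp_of_mem ?_ (List.nodup_range (n := t))
    intro a b ha hb hab
    simp only [Function.onFun, List.disjoint_left, billiardSegment, mem_fibreOrbit]
    rintro y ⟨s, -, rfl⟩ ⟨s', -, h⟩
    simp only [List.mem_range] at ha hb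
    have := hp.getVert_injOn (by simp; omega) (by simp; omega) (Prod.ext_iff.1 h).1
    omega

theorem disjoint_billiardPath {d : ℕ} (hp : p.IsPath) (z : ZMod n) {t : ℕ} (ht : t < p.length)
    (hprog : ∀ t ≤ p.length, IsProgressionOn d (Γ.loop u) (Γ.billiardArrive p d t)) {i j : ℕ}
    (hi : i < d) (hj : j < d) (hij : i ≠ j) {y : V × ZMod n} (hy : y ∈ Γ.billiardPath p d z i t) :
    y ∉ Γ.billiardPath p d z j t := by
  rw [mem_billiardPath] at hy ⊢
  obtain ⟨a, ha, hat, s, hs, rfl⟩ := hy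
  rintro ⟨b, hb, hbt, s', hs', h⟩
  obtain ⟨h1, h2⟩ := Prod.ext_iff.1 h
  have hab : a = b := hp.getVert_injOn (by simp; omega) (by simp; omega) h1
  subst hab
  simp only [add_assoc] at h2
  have := (eq_of_fibreSteps_le (S := {x | ∃ k < d, x = Γ.billiardArrive p d a k})
    ⟨i, hi, rfl⟩ ⟨j, hj, rfl⟩ hs hs' (add_left_cancel h2)).1
  exact hij ((hprog a (by omega)).1 i hi j hj this)

variable [NeZero n]

theorem isProgressionOn_billiardArrive {d : ℕ} (hd : d ≤ n)
    (hr : Nat.Coprime (Γ.loop u).val n)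
    (hgcd : ∀ t, 0 < t → t < p.length → Nat.gcd n (Γ.loop (p.getVert t)).val ≤ d) :
    ∀ t ≤ p.length, IsProgressionOn d (Γ.loop u) (Γ.billiardArrive p d t)
  | 0, _ => by
    refine ⟨fun i hi j hj h => nsmul_left_inj_of_coprime hr (hi.trans_le hd) (hj.trans_le hd) h,
      0, fun x => ?_⟩
    simp [billiardArrive]
  | t + 1, ht => by
    have ih := isProgressionOn_billiardArrive hd hr hgcd t (by omega)
    refine IsProgressionOn.add_const (f := Γ.billiardDepart p d t) ?_ _
    rcases Nat.eq_zero_or_pos t with rfl | hpos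
    · exact ih
    · have := ih.fibreExit hr (hgcd t hpos (by omega))
      convert this using 2 with j
      rw [billiardDepart, billiardExit, if_neg hpos.ne']

theorem exists_mem_billiardPath {d : ℕ} (hr : Nat.Coprime (Γ.loop u).val n)
    (hgcd : ∀ t, 0 < t → t < p.length → Nat.gcd n (Γ.loop (p.getVert t)).val ≤ d)
    (hprog : ∀ t ≤ p.length, IsProgressionOn d (Γ.loop u) (Γ.billiardArrive p d t)) (z : ZMod n)
    {t : ℕ} (ht : t < p.length) {i : ℕ} (h0 : 0 < i) (hi : i ≤ t) (x : ZMod n) :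
    ∃ j < d, (p.getVert i, x) ∈ Γ.billiardPath p d z j t := by
  obtain ⟨b, hb⟩ := (hprog i (by omega)).2
  obtain ⟨m, k, hk, hm⟩ :=
    exists_sub_nsmul_eq_add_nsmul hr (hgcd i h0 (by omega)) b (x - z)
  obtain ⟨x', ⟨j, hj, rfl⟩, s, hs, hx⟩ :=
    exists_eq_add_nsmul_of_le_fibreSteps
      (S := {x | ∃ k < d, x = Γ.billiardArrive p d i k}) ⟨m, (hb _).2 ⟨k, hk, hm⟩⟩
  refine ⟨j, hj, mem_billiardPath.2 ⟨i, h0, hi, s, hs, ?_⟩⟩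
  rw [add_assoc, ← hx]
  simp

end Billiard

/-! ### Bridges: an odd shifting path seen from its two ends. -/

section Bridge

variable {V : Type*} {n : ℕ} (Γ : ReflexiveVoltageGraph V n)

/-- For every `z` there are `d` disjoint paths of the covering graph that start at the vertices
`(u, z + j r)`, where `j < d` and `r` is the loop voltage of `u`, partition the fibres over `I`,
and end at consecutive vertices of the fibre over `v`, with the order shifted by an odd number. -/
def IsBridge (u v : V) (I : Set V) (d : ℕ) : Prop :=
  ∃ s, Odd s ∧ 0 < s ∧ s < d ∧ ∃ β : ZMod n, ∀ z : ZMod n, ∃ W : ℕ → List (V × ZMod n),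
    (∀ j < d, List.IsChain Γ.cover.Adj
      ((u, z + j • Γ.loop u) :: W j ++ [(v, z + β + ((j + s) % d) • Γ.loop u)])) ∧
    (∀ j < d, (W j).Nodup) ∧ (∀ i < d, ∀ j < d, i ≠ j → ∀ x ∈ W i, x ∉ W j) ∧
    ∀ x, (∃ j < d, x ∈ W j) ↔ x.1 ∈ I

variable {Γ}

/-- Traversing the paths backwards turns the shift `s` into `d - s`, which is odd because `d` is
even. This allows a path to be attached at either end. -/
theorem IsBridge.symm {u v : V} {I : Set V} {d : ℕ} (h : Γ.IsBridge u v I d)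
    (huv : Γ.loop u = Γ.loop v) (hd : Even d) : Γ.IsBridge v u I d := by
  obtain ⟨s, hs, hs0, hsd, β, H⟩ := h
  refine ⟨d - s, Nat.Even.sub_odd hsd.le hd hs, by omega, by omega, -β, fun z => ?_⟩
  obtain ⟨W, h1, h2, h3, h4⟩ := H (z - β)
  have hlt : ∀ k, (k + (d - s)) % d < d := fun k => Nat.mod_lt _ (by omega)
  have hmod : ∀ k < d, ((k + (d - s)) % d + s) % d = k := by
    intro k hk
    rw [Nat.mod_add_mod, show k + (d - s) + s = k + d by omega, Nat.add_mod_right,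
      Nat.mod_eq_of_lt hk]
  refine ⟨fun k => (W ((k + (d - s)) % d)).reverse, fun k hk => ?_,
    fun k _ => List.nodup_reverse.2 (h2 _ (hlt k)), fun k hk k' hk' hne x hx => ?_, fun x => ?_⟩
  · have := h1 _ (hlt k)
    rw [hmod k hk, ← List.isChain_reverse.trans (List.IsChain.iff fun a b => Γ.cover.adj_comm _ _)]
      at this
    rw [← huv]
    simpa [← sub_eq_add_neg] using this
  · rw [List.mem_reverse] at hx ⊢
    refine h3 _ (hlt k) _ (hlt k') (fun he => hne ?_) x hx
    rw [← hmod k hk, he, hmod k' hk']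
  · rw [← h4 x]
    constructor
    · rintro ⟨k, _, hk⟩
      exact ⟨_, hlt k, List.mem_reverse.1 hk⟩
    · rintro ⟨j, hj, hx⟩
      refine ⟨(j + s) % d, Nat.mod_lt _ (by omega), ?_⟩
      rw [List.mem_reverse, Nat.mod_add_mod, show j + s + (d - s) = j + d by omega,
        Nat.add_mod_right, Nat.mod_eq_of_lt hj]
      exact hx

variable {u v : V} {p : Γ.graph.Walk u v}

/-- Without internal vertices the order stays the identity: a shift by `s` would force `(d - s) r =
0`, although `d - s` is smaller than the order of `r`. -/
theorem IsOddShifting.two_le_length (h : Γ.IsOddShifting p) : 2 ≤ p.length := by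
  obtain ⟨-, hord, s, hs, hs0, hsd, ho⟩ := h
  by_contra hlt
  have hL : p.length - 1 = 0 := by omega
  have h0 := ho 0 (by omega)
  rw [hL] at h0
  simp only [hs0, if_true, add_zero, billiardDepart, billiardExit, departBase, arriveBase,
    billiardArrive, zero_nsmul] at h0
  have hdvd := addOrderOf_dvd_of_nsmul_eq_zero h0
  have := Nat.le_of_dvd (by omega) hdvd
  omega

variable [NeZero n]

theorem IsOddShifting.two_mul_pathC_le (h : Γ.IsOddShifting p) : 2 * Γ.pathC p ≤ n := by
  refine h.2.1.trans ?_
  have := addOrderOf_le_card_univ (x := Γ.loop u)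
  rwa [ZMod.card] at this

theorem IsOddShifting.isBridge (h : Γ.IsOddShifting p) (hp : p.IsPath)
    (hr : Nat.Coprime (Γ.loop u).val n) :
    Γ.IsBridge u v {w | w ∈ p.support ∧ w ≠ u ∧ w ≠ v} (2 * Γ.pathC p) := by
  have hL := h.two_le_length
  have hd := h.two_mul_pathC_le
  have hgcd : ∀ t, 0 < t → t < p.length →
      Nat.gcd n (Γ.loop (p.getVert t)).val ≤ 2 * Γ.pathC p := by
    intro t h0 ht
    have : Nat.gcd n (Γ.loop (p.getVert t)).val ≤ (Finset.Ioo 0 p.length).sup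
        (fun t => Nat.gcd n (Γ.loop (p.getVert t)).val) :=
      Finset.le_sup (f := fun t => Nat.gcd n (Γ.loop (p.getVert t)).val)
        (Finset.mem_Ioo.2 ⟨h0, ht⟩)
    rw [pathC, if_neg (by omega)]
    omega
  obtain ⟨-, -, s, hs, hs0, hsd, ho⟩ := h
  generalize 2 * Γ.pathC p = d at *
  have hprog := isProgressionOn_billiardArrive (p := p) hd hr hgcd
  have hlt : p.length - 1 < p.length := by omega
  have hL1 : p.length - 1 + 1 = p.length := by omega
  refine ⟨s, hs, hs0, hsd, Γ.departBase p (p.length - 1) +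
    Γ.edge (p.getVert (p.length - 1)) (p.getVert (p.length - 1 + 1)), fun z =>
    ⟨fun j => Γ.billiardPath p d z j (p.length - 1), fun j hj => ?_,
      fun j hj => nodup_billiardPath hp hj z hlt,
      fun i hi j hj hij x hx => disjoint_billiardPath hp z hlt hprog hi hj hij hx, fun x => ?_⟩⟩
  · have hc := isChain_billiardPath (Γ := Γ) (p := p) hj z _ hlt
    convert hc using 3
    congr 1
    · rw [hL1, p.getVert_length]
    · have hk : (j + s) % d < d := Nat.mod_lt _ (by omega)
      have := ho _ hk
      -- The order lists paths by position; inverted, it puts `P_j` at position `j + s` modulo `d`.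
      have hπ : (if (j + s) % d < s then d - s + (j + s) % d else (j + s) % d - s) = j := by
        rcases lt_or_ge (j + s) d with h' | h'
        · rw [Nat.mod_eq_of_lt h', if_neg (by omega)]; omega
        · rw [Nat.mod_eq_sub_mod h', Nat.mod_eq_of_lt (by omega), if_pos (by omega)]; omega
      simp only [hπ] at this
      change _ = z + (Γ.billiardDepart p d (p.length - 1) j + _)
      rw [this]
      abel
  · constructor
    · rintro ⟨j, hj, hx⟩
      obtain ⟨i, h0, hi, s, -, rfl⟩ := mem_billiardPath.1 hx
      refine ⟨p.getVert_mem_support i, fun h => ?_, fun h => ?_⟩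
      · have := hp.getVert_injOn (x₁ := i) (x₂ := 0) (by simp; omega) (by simp) (by simpa using h)
        omega
      · have := hp.getVert_injOn (x₁ := i) (x₂ := p.length) (by simp; omega) (by simp)
          (by simpa using h)
        omega
    · obtain ⟨w, x⟩ := x
      rintro ⟨hw, hwu, hwv⟩
      obtain ⟨i, rfl, hi⟩ := SimpleGraph.Walk.mem_support_iff_exists_getVert.1 hw
      refine exists_mem_billiardPath hr hgcd hprog z hlt (Nat.pos_of_ne_zero ?_) ?_ x
      · rintro rfl
        simp at hwu
      · by_contra hi'
        have : i = p.length := by omega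
        subst this
        simp at hwv

end Bridge

end ReflexiveVoltageGraph

/-! ### Detours through a bridge. -/

theorem fibreOrbit_succ {V : Type*} {n : ℕ} (v : V) (x a : ZMod n) (e : ℕ) :
    fibreOrbit v x a (e + 1) = fibreOrbit v x a e ++ [(v, x + (e + 1) • a)] := by
  rw [fibreOrbit, List.range_succ, List.map_append]
  rfl

section

variable {n : ℕ} [NeZero n]

theorem nsmul_left_inj_of_coprime_of_pos {r : ZMod n} (hr : Nat.Coprime r.val n) {i j : ℕ}
    (hi0 : 0 < i) (hj0 : 0 < j) (hi : i ≤ n) (hj : j ≤ n) (h : i • r = j • r) : i = j := by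
  obtain ⟨i, rfl⟩ := Nat.exists_eq_add_of_lt hi0
  obtain ⟨j, rfl⟩ := Nat.exists_eq_add_of_lt hj0
  rw [succ_nsmul, succ_nsmul] at h
  have := nsmul_left_inj_of_coprime hr (by omega) (by omega) (add_right_cancel h)
  omega

theorem exists_lt_eq_nsmul_of_coprime {r : ZMod n} (hr : Nat.Coprime r.val n) (x : ZMod n) :
    ∃ i < n, x = i • r := by
  have hu : IsUnit r := by
    rw [← ZMod.natCast_zmod_val r]
    exact (ZMod.isUnit_iff_coprime _ _).2 hr
  obtain ⟨u, hu'⟩ := hu.exists_left_inv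
  refine ⟨(x * u).val, ZMod.val_lt _, ?_⟩
  rw [nsmul_eq_mul, ZMod.natCast_zmod_val, mul_assoc, hu', mul_one]

end

namespace ReflexiveVoltageGraph

variable {V : Type*} {n : ℕ} (Γ : ReflexiveVoltageGraph V n)

/-- `x` and `y` are adjacent in the covering graph, and `y` is the successor of `x` along the
primary loop arc unless `x ∈ K`. -/
def StepRel (K : Set (V × ZMod n)) (x y : V × ZMod n) : Prop :=
  Γ.cover.Adj x y ∧ (x ∉ K → y = (x.1, x.2 + Γ.loop x.1))

variable {Γ}

theorem StepRel.mono {K K' : Set (V × ZMod n)} (h : K ⊆ K') {x y : V × ZMod n}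
    (hxy : Γ.StepRel K x y) : Γ.StepRel K' x y :=
  ⟨hxy.1, fun hx => hxy.2 fun hx' => hx (h hx')⟩

theorem isChain_stepRel_of_subset {K : Set (V × ZMod n)} {l : List (V × ZMod n)}
    (hl : List.IsChain Γ.cover.Adj l) (hK : ∀ x ∈ l, x ∈ K) : List.IsChain (Γ.StepRel K) l :=
  hl.imp_of_mem_imp fun x _ hx _ hxy => ⟨hxy, fun hx' => absurd (hK x hx) hx'⟩

theorem stepRel_loop {w : V} (hw : Γ.loop w ≠ 0) (K : Set (V × ZMod n)) (x : ZMod n) :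
    Γ.StepRel K (w, x) (w, x + Γ.loop w) :=
  ⟨cover_adj_loop hw x, fun _ => rfl⟩

/-- The vertices of the cover that need not be followed by their successors along the loop after a
bridge from `u` to `v` with interior `I` has been traversed by `d` paths. -/
def bridgeVertices (Γ : ReflexiveVoltageGraph V n) (u v : V) (I : Set V) (d : ℕ)
    (z b : ZMod n) : Set (V × ZMod n) :=
  {x | x.1 ∈ I ∨ (∃ m < d, x = (u, z + m • Γ.loop u)) ∨ ∃ m < d, x = (v, b + m • Γ.loop v)}

/-- Given a bridge from `u` to `v`, the steps from `(u, z + 2 i r)` to `(u, z + (2 i + 1) r)` can be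
replaced by disjoint paths that cover the fibre over `v` and the fibres inside the bridge. -/
theorem IsBridge.exists_detours [NeZero n] {u v : V} {I : Set V} {c : ℕ}
    (h : Γ.IsBridge u v I (2 * c)) (hcn : 2 * c ≤ n) (hr : Nat.Coprime (Γ.loop u).val n)
    (huv : Γ.loop u = Γ.loop v) (hv : v ∉ I) (z : ZMod n) :
    ∃ (b : ZMod n) (w : ℕ → List (V × ZMod n)),
      (∀ i < c, List.IsChain (Γ.StepRel (Γ.bridgeVertices u v I (2 * c) z b))
        ((u, z + (2 * i) • Γ.loop u) :: w i ++ [(u, z + (2 * i + 1) • Γ.loop u)])) ∧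
      (∀ i < c, (w i).Nodup) ∧ (∀ i < c, ∀ j < c, i ≠ j → ∀ x ∈ w i, x ∉ w j) ∧
      ∀ x, (∃ i < c, x ∈ w i) ↔ x.1 ∈ I ∨ x.1 = v := by
  obtain ⟨s, ⟨s, rfl⟩, hs0, hsd, β, H⟩ := h
  obtain ⟨W, hch, hnd, hdis, hcov⟩ := H z
  have hWI : ∀ j < 2 * c, ∀ x ∈ W j, x.1 ∈ I := fun j hj x hx => (hcov x).1 ⟨j, hj, hx⟩
  generalize hb : z + β = b at hch
  set r := Γ.loop u with hrdef
  have hr0 : r ≠ 0 := by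
    intro h0
    have := nsmul_left_inj_of_coprime hr (i := 0) (j := 1) (by omega) (by omega) (by simp [h0])
    omega
  obtain ⟨q, hq⟩ : ∃ q : ℕ → ℕ, ∀ j, q j = (j + (2 * s + 1)) % (2 * c) := ⟨_, fun _ => rfl⟩
  simp only [← hq] at hch
  have hqval : ∀ j < 2 * c, q j < 2 * c ∧ (q j = j + (2 * s + 1) ∨
      q j + 2 * c = j + (2 * s + 1)) := by
    intro j hj
    rw [hq]
    refine ⟨Nat.mod_lt _ (by omega), ?_⟩
    rcases lt_or_ge (j + (2 * s + 1)) (2 * c) with h' | h'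
    · left; rw [Nat.mod_eq_of_lt h']
    · right; rw [Nat.mod_eq_sub_mod h', Nat.mod_eq_of_lt (by omega)]; omega
  clear hq
  -- A stretch over `v` takes `e i + 1` loop steps: one, except for the stretch from position `2c -
  -- 1`, which goes on around the fibre to position `n`, that is, 0.
  obtain ⟨e, he⟩ : ∃ e : ℕ → ℕ, ∀ i, e i = if q (2 * i) + 1 = 2 * c then n - 2 * c else 0 :=
    ⟨_, fun _ => rfl⟩
  -- The oddness of the shift enters here: `q (2 * i)` is odd, so `q (2 * i + 1)` is its successor
  -- unless the pair wraps around at `2c`.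
  have hqe : ∀ i < c, q (2 * i) + (e i + 1) ≤ n ∧
      (q (2 * i) + 1 = 2 * c ∧ q (2 * i + 1) = 0 ∧ q (2 * i) + (e i + 1) = n ∨
        q (2 * i) + 1 < 2 * c ∧ q (2 * i + 1) = q (2 * i) + 1 ∧ e i = 0) := by
    intro i hi
    have h1 := hqval (2 * i) (by omega)
    have h2 := hqval (2 * i + 1) (by omega)
    have h3 := he i
    split_ifs at h3 <;> omega
  have hqend : ∀ i < c, b + q (2 * i) • r + (e i + 1) • r = b + q (2 * i + 1) • r := by
    intro i hi
    rw [add_assoc, ← add_nsmul]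
    rcases (hqe i hi).2 with ⟨-, h2, h3⟩ | ⟨-, h2, h3⟩
    · rw [h3, h2, nsmul_eq_mul, nsmul_eq_mul]; simp
    · rw [h2, h3]
  set K := Γ.bridgeVertices u v I (2 * c) z b with hK
  have hKu : ∀ m < 2 * c, (u, z + m • r) ∈ K := fun m hm => Or.inr (Or.inl ⟨m, hm, rfl⟩)
  have hKv : ∀ m < 2 * c, (v, b + m • r) ∈ K := fun m hm =>
    Or.inr (Or.inr ⟨m, hm, by rw [← huv]⟩)
  have hKch : ∀ j < 2 * c, List.IsChain (Γ.StepRel K)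
      ((u, z + j • r) :: W j ++ [(v, b + q j • r)]) := by
    intro j hj
    refine isChain_stepRel_of_subset (hch j hj) ?_
    intro x hx
    simp only [List.cons_append, List.mem_cons, List.mem_append, List.not_mem_nil, or_false] at hx
    rcases hx with rfl | hx | rfl
    · exact hKu j hj
    · exact Or.inl (hWI j hj x hx)
    · exact hKv _ (hqval j hj).1
  have hKch' : ∀ j < 2 * c, List.IsChain (Γ.StepRel K)
      ((v, b + q j • r) :: (W j).reverse ++ [(u, z + j • r)]) := by
    intro j hj
    have := hch j hj
    rw [← List.isChain_reverse.trans (List.IsChain.iff fun a b => Γ.cover.adj_comm _ _)] at this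
    refine isChain_stepRel_of_subset (by simpa using this) ?_
    intro x hx
    simp only [List.cons_append, List.mem_cons, List.mem_append, List.not_mem_nil, or_false,
      List.mem_reverse] at hx
    rcases hx with rfl | hx | rfl
    · exact hKv _ (hqval j hj).1
    · exact Or.inl (hWI j hj x hx)
    · exact hKu j hj
  obtain ⟨seg, hseg⟩ : ∃ seg : ℕ → List (V × ZMod n), ∀ i,
      seg i = fibreOrbit v (b + q (2 * i) • r) r (e i + 1) := ⟨_, fun _ => rfl⟩
  have mem_seg : ∀ i y, y ∈ seg i ↔ ∃ m ≤ e i + 1, y = (v, b + (q (2 * i) + m) • r) := by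
    intro i y
    simp only [hseg, mem_fibreOrbit, add_nsmul, add_assoc]
  have hsegv : ∀ i, ∀ y ∈ seg i, y.1 = v := by
    intro i y hy
    obtain ⟨m, -, rfl⟩ := (mem_seg i y).1 hy
    rfl
  have hWseg : ∀ j < 2 * c, ∀ i, ∀ y ∈ W j, y ∉ seg i := fun j hj i y hy hy' =>
    hv (hsegv i y hy' ▸ hWI j hj y hy)
  refine ⟨b, fun i => W (2 * i) ++ seg i ++ (W (2 * i + 1)).reverse, ?_, ?_, ?_, ?_⟩
  · intro i hi
    have h1 := hKch (2 * i) (by omega)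
    have h2 := hKch' (2 * i + 1) (by omega)
    have h3 : List.IsChain (Γ.StepRel K) (fibreOrbit v (b + q (2 * i) • r) r (e i) ++
        [(v, b + q (2 * i + 1) • r)]) := by
      have step : ∀ x, Γ.StepRel K (v, x) (v, x + r) := fun x => by
        have := stepRel_loop (w := v) (by rwa [← huv]) K x
        rwa [← huv] at this
      refine isChain_fibreOrbit ?_ ?_
      · intro m _
        rw [add_nsmul, one_nsmul, ← add_assoc]
        exact step _
      · rw [← hqend i hi, add_nsmul r (e i) 1, one_nsmul, ← add_assoc (b + _)]
        exact step _
    have h4 : List.IsChain (Γ.StepRel K) (seg i ++ (W (2 * i + 1)).reverse ++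
        [(u, z + (2 * i + 1) • r)]) := by
      rw [hseg, fibreOrbit_succ, hqend i hi]
      simpa using List.isChain_split.2 ⟨h3, h2⟩
    simp only [hseg, fibreOrbit_eq_cons, List.cons_append, List.append_assoc] at h1 h4 ⊢
    exact List.isChain_cons_split.2 ⟨h1, h4⟩
  · intro i hi
    have hdisj : ∀ x ∈ W (2 * i), x ∉ W (2 * i + 1) :=
      hdis _ (by omega) _ (by omega) (by omega)
    have hsegnd : (seg i).Nodup := by
      rw [hseg]
      refine nodup_fibreOrbit fun m hm m' hm' hmm => ?_
      rw [add_assoc, add_assoc, ← add_nsmul, ← add_nsmul] at hmm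
      have h1 := hqe i hi
      have h2 := hqval (2 * i) (by omega)
      have := nsmul_left_inj_of_coprime_of_pos hr (by omega) (by omega) (by omega) (by omega)
        (add_left_cancel hmm)
      omega
    refine List.Nodup.append (List.Nodup.append (hnd _ (by omega)) hsegnd ?_)
      (List.nodup_reverse.2 (hnd _ (by omega))) ?_
    · exact List.disjoint_left.2 fun y hy => hWseg _ (by omega) _ y hy
    · refine List.disjoint_left.2 fun y hy hy' => ?_
      rw [List.mem_reverse] at hy'
      rcases List.mem_append.1 hy with hy | hy
      · exact hdisj y hy hy'
      · exact hWseg _ (by omega) _ y hy' hy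
  · intro i hi j hj hij x hx hx'
    simp only [List.mem_append, List.mem_reverse] at hx hx'
    have hWW : ∀ a < 2 * c, ∀ a' < 2 * c, a ≠ a' → x ∈ W a → x ∈ W a' → False :=
      fun a ha a' ha' hne h1 h2 => hdis a ha a' ha' hne x h1 h2
    rcases hx with (hx | hx) | hx <;> rcases hx' with (hx' | hx') | hx'
    · exact hWW _ (by omega) _ (by omega) (by omega) hx hx'
    · exact hWseg _ (by omega) _ x hx hx'
    · exact hWW _ (by omega) _ (by omega) (by omega) hx hx'
    · exact hWseg _ (by omega) _ x hx' hx
    · obtain ⟨m, hm, rfl⟩ := (mem_seg i x).1 hx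
      obtain ⟨m', hm', hmm⟩ := (mem_seg j _).1 hx'
      have hmm := (Prod.ext_iff.1 hmm).2
      have h1 := hqe i hi
      have h2 := hqval (2 * i) (by omega)
      have h3 := hqe j hj
      have h4 := hqval (2 * j) (by omega)
      have := nsmul_left_inj_of_coprime_of_pos hr (by omega) (by omega) (by omega) (by omega)
        (add_left_cancel hmm)
      omega
    · exact hWseg _ (by omega) _ x hx' hx
    · exact hWW _ (by omega) _ (by omega) (by omega) hx hx'
    · exact hWseg _ (by omega) _ x hx hx'
    · exact hWW _ (by omega) _ (by omega) (by omega) hx hx'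
  · intro x
    constructor
    · rintro ⟨i, hi, hx⟩
      simp only [List.mem_append, List.mem_reverse] at hx
      rcases hx with (hx | hx) | hx
      · exact Or.inl (hWI _ (by omega) x hx)
      · exact Or.inr (hsegv i x hx)
      · exact Or.inl (hWI _ (by omega) x hx)
    · rintro (hx | hx)
      · obtain ⟨j, hj, hx⟩ := (hcov x).2 hx
        refine ⟨j / 2, by omega, ?_⟩
        simp only [List.mem_append, List.mem_reverse]
        rcases Nat.mod_two_eq_zero_or_one j with h' | h'
        · rw [show 2 * (j / 2) = j by omega]; exact Or.inl (Or.inl hx)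
        · rw [show 2 * (j / 2) + 1 = j by omega]; exact Or.inr hx
      · obtain ⟨w, y⟩ := x
        obtain rfl : w = v := hx
        -- Positions are taken in `1, …, n` rather than `0, …, n - 1`, so that no stretch is cut:
        -- each begins at an odd position and ends at or before `n`.
        obtain ⟨a, ha0, han, hay⟩ : ∃ a : ℕ, 0 < a ∧ a ≤ n ∧ y = b + a • r := by
          obtain ⟨a, ha, hay⟩ := exists_lt_eq_nsmul_of_coprime hr (y - b)
          rcases Nat.eq_zero_or_pos a with rfl | hpos
          · refine ⟨n, by omega, le_rfl, ?_⟩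
            rw [nsmul_eq_mul, ZMod.natCast_self, zero_mul, add_zero]
            rw [zero_nsmul] at hay
            exact sub_eq_zero.1 hay
          · exact ⟨a, hpos, ha.le, by rw [← hay]; abel⟩
        obtain ⟨i, hi, m, hm, ham⟩ : ∃ i < c, ∃ m ≤ e i + 1, q (2 * i) + m = a := by
          -- Every odd position in the block is the start of a stretch; solve `2i + 2s + 1 = 2t + 1`
          -- modulo `2c`.
          have key : ∀ t, 2 * t + 1 < 2 * c → ∃ i < c, q (2 * i) = 2 * t + 1 := by
            intro t ht
            rcases le_or_gt s t with h' | h'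
            · have := hqval (2 * (t - s)) (by omega)
              exact ⟨t - s, by omega, by omega⟩
            · have := hqval (2 * (t + c - s)) (by omega)
              exact ⟨t + c - s, by omega, by omega⟩
          rcases le_or_gt (2 * c) (a + 1) with h' | h'
          · obtain ⟨i, hi, hqi⟩ := key (c - 1) (by omega)
            have := hqe i hi
            exact ⟨i, hi, a - q (2 * i), by omega, by omega⟩
          · obtain ⟨i, hi, hqi⟩ := key ((a - 1) / 2) (by omega)
            exact ⟨i, hi, a - q (2 * i), by omega, by omega⟩
        refine ⟨i, hi, ?_⟩
        simp only [List.mem_append]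
        exact Or.inl (Or.inr ((mem_seg i _).2 ⟨m, hm, by rw [ham, hay]⟩))

end ReflexiveVoltageGraph

/-! ### Reserved blocks and partial cycles. -/

namespace ReflexiveVoltageGraph

variable {V : Type*} [DecidableEq V] {n : ℕ} {Γ : ReflexiveVoltageGraph V n} {k : ℕ}
  {src tgt : Fin k → V} (Q : ∀ i, Γ.graph.Path (src i) (tgt i))

/-- The position, in the fibre over `w`, of the block of `2 c(Q_i)` vertices reserved for `Q_i`. -/
def blockStart (w : V) (i : Fin k) : ℕ :=
  ∑ j with j < i, if w = src j ∨ w = tgt j then 2 * Γ.pathC (Q j).1 else 0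

variable {Q}

theorem blockStart_add_eq_sum {w : V} {i : Fin k} (hi : w = src i ∨ w = tgt i) :
    blockStart Q w i + 2 * Γ.pathC (Q i).1 =
      ∑ j ∈ insert i (Finset.univ.filter (· < i)),
        if w = src j ∨ w = tgt j then 2 * Γ.pathC (Q j).1 else 0 := by
  rw [Finset.sum_insert (by simp), if_pos hi, add_comm, blockStart]

theorem blockStart_add_le {w : V} {i j : Fin k} (hij : i < j) (hi : w = src i ∨ w = tgt i) :
    blockStart Q w i + 2 * Γ.pathC (Q i).1 ≤ blockStart Q w j := by
  rw [blockStart_add_eq_sum hi]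
  refine Finset.sum_le_sum_of_subset fun a ha => ?_
  simp only [Finset.mem_insert, Finset.mem_filter, Finset.mem_univ, true_and] at ha ⊢
  rcases ha with rfl | ha
  · exact hij
  · exact ha.trans hij

theorem blockStart_add_le_treeWeight {w : V} {i : Fin k} (hi : w = src i ∨ w = tgt i) :
    blockStart Q w i + 2 * Γ.pathC (Q i).1 ≤ Γ.treeWeight Q w := by
  rw [blockStart_add_eq_sum hi]
  exact Finset.sum_le_sum_of_subset (Finset.subset_univ _)

variable (Q)

/-- There is a cyclic arrangement of the fibres over `C` which, in every fibre, follows the loop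
except in the blocks that are reserved for the paths `Q_i` with `i ∈ P`. -/
def HasPartialCycle (C : Set V) (P : Set (Fin k)) : Prop :=
  ∃ (K : Set (V × ZMod n)) (o : V → ZMod n), CyclicOn (Γ.StepRel K) {x | x.1 ∈ C} ∧
    ∀ x ∈ K, x.1 ∈ C ∧ ∀ i, i ∉ P → (x.1 = src i ∨ x.1 = tgt i) →
      ∃ j ∈ P, (x.1 = src j ∨ x.1 = tgt j) ∧ ∃ m < 2 * Γ.pathC (Q j).1,
        x.2 = o x.1 + (blockStart Q x.1 j + m) • Γ.loop x.1

variable {Q}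

section Insertion

variable [NeZero n]

theorem HasPartialCycle.insert {C : Set V} {P : Set (Fin k)} (h : HasPartialCycle Q C P)
    (hweight : Γ.IsProperlyWeighted Q) {i : Fin k} (hi : i ∉ P) {u v : V} {I : Set V}
    (hu : u = src i ∨ u = tgt i) (hv : v = src i ∨ v = tgt i)
    (hbridge : Γ.IsBridge u v I (2 * Γ.pathC (Q i).1)) (hr : Nat.Coprime (Γ.loop u).val n)
    (huv : Γ.loop u = Γ.loop v) (huC : u ∈ C) (hvC : v ∉ C) (hvI : v ∉ I)
    (hIC : ∀ w ∈ I, w ∉ C) (hI : ∀ w ∈ I, ∀ j, ¬ (w = src j ∨ w = tgt j)) :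
    HasPartialCycle Q (C ∪ {w | w ∈ I ∨ w = v}) (Insert.insert i P) := by
  obtain ⟨K, o, hcyc, hK⟩ := h
  have hne : u ≠ v := fun h => hvC (h ▸ huC)
  have hn : ∀ {w : V} {j : Fin k}, (w = src j ∨ w = tgt j) →
      blockStart Q w j + 2 * Γ.pathC (Q j).1 ≤ n := fun {w j} hj =>
    (blockStart_add_le_treeWeight hj).trans (hweight w ⟨j, hj⟩)
  have hcn : 2 * Γ.pathC (Q i).1 ≤ n := le_trans (Nat.le_add_left _ _) (hn hu)
  obtain ⟨b, w, hch, hnd, hdis, hcov⟩ := hbridge.exists_detours hcn hr huv hvI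
    (o u + blockStart Q u i • Γ.loop u)
  set z := o u + blockStart Q u i • Γ.loop u with hz
  -- Distinct blocks in a fibre are disjoint, since all of them fit into `n` positions by proper
  -- weighting. The block of `Q_i` is thus still traversed by loop steps.
  have htail : ∀ a < Γ.pathC (Q i).1, (u, z + (2 * a) • Γ.loop u) ∉ K := by
    intro a ha hmem
    obtain ⟨j, hj, huj, m, hm, he⟩ := (hK _ hmem).2 i hi hu
    replace huj : u = src j ∨ u = tgt j := huj
    have he : z + (2 * a) • Γ.loop u = o u + (blockStart Q u j + m) • Γ.loop u := he
    rw [hz, add_assoc, ← add_nsmul] at he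
    have h1 := hn hu
    have h2 := hn huj
    have := nsmul_left_inj_of_coprime hr (by omega) (by omega) (add_left_cancel he)
    have hij : i ≠ j := fun h => hi (h ▸ hj)
    rcases lt_or_gt_of_ne hij with h | h
    · have := blockStart_add_le (Q := Q) h hu
      omega
    · have := blockStart_add_le (Q := Q) h huj
      omega
  refine ⟨K ∪ Γ.bridgeVertices u v I (2 * Γ.pathC (Q i).1) z b,
    -- The bridge dictates where the paths land over `v`; the still free origin of that fibre is
    -- chosen so that they land in the block reserved for `Q_i`.
    Function.update o v (b - blockStart Q v i • Γ.loop v), ?_, ?_⟩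
  · have := hcyc.insert (ι := Fin (Γ.pathC (Q i).1))
      (R' := Γ.StepRel (K ∪ Γ.bridgeVertices u v I (2 * Γ.pathC (Q i).1) z b))
      (tail := fun a => (u, z + (2 * a.1) • Γ.loop u)) (w := fun a => w a) ?_ (fun _ => huC)
      (fun a => hnd a a.2) (fun a a' haa => hdis a a.2 a' a'.2 (fun h => haa (Fin.ext h))) ?_
      (fun _ _ h => h.mono Set.subset_union_left) ?_
    · convert this using 1
      ext x
      have := hcov x
      simp only [Set.mem_union, Set.mem_ofPred_eq, ← this]
      refine or_congr_right ⟨fun ⟨a, ha, hx⟩ => ⟨⟨a, ha⟩, hx⟩, fun ⟨a, hx⟩ => ⟨a, a.2, hx⟩⟩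
    · intro a a' haa
      have := (Prod.ext_iff.1 haa).2
      have := nsmul_left_inj_of_coprime hr (by omega) (by omega) (add_left_cancel this)
      exact Fin.ext (by omega)
    · intro a y hy hyC
      rcases (hcov y).1 ⟨a, a.2, hy⟩ with h | h
      · exact hIC _ h hyC
      · exact hvC (h ▸ hyC)
    · intro a y hy
      have hy' := hy.2 (htail a a.2)
      have := hch a a.2
      rw [hy', show (u, z + (2 * a.1) • Γ.loop u).2 + Γ.loop (u, z + (2 * a.1) • Γ.loop u).1 =
        z + (2 * a.1 + 1) • Γ.loop u by rw [add_nsmul _ _ 1, one_nsmul, add_assoc]]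
      exact this.imp fun _ _ h => h.mono Set.subset_union_right
  · rintro ⟨y, x⟩ (hx | hx | ⟨m, hm, hx⟩ | ⟨m, hm, hx⟩)
    · obtain ⟨h1, h2⟩ := hK _ hx
      refine ⟨Or.inl h1, fun i' hi' hy => ?_⟩
      obtain ⟨j, hj, hyj, m, hm, he⟩ := h2 i' (fun h => hi' (Or.inr h)) hy
      refine ⟨j, Or.inr hj, hyj, m, hm, ?_⟩
      rw [Function.update_of_ne (fun h : y = v => hvC (h ▸ h1)), he]
    · exact ⟨Or.inr (Or.inl hx), fun i' _ hy => absurd hy (hI _ hx i')⟩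
    · rw [Prod.mk.injEq] at hx
      obtain ⟨rfl, rfl⟩ := hx
      refine ⟨Or.inl huC, fun _ _ _ => ⟨i, Or.inl rfl, hu, m, hm, ?_⟩⟩
      dsimp only
      rw [Function.update_of_ne hne, add_nsmul, hz, add_assoc]
    · rw [Prod.mk.injEq] at hx
      obtain ⟨rfl, rfl⟩ := hx
      refine ⟨Or.inr (Or.inr rfl), fun _ _ _ => ⟨i, Or.inl rfl, hv, m, hm, ?_⟩⟩
      dsimp only
      rw [Function.update_self, add_nsmul]
      abel

theorem hasPartialCycle_singleton {w : V} (hw : Γ.loop w ≠ 0)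
    (hr : Nat.Coprime (Γ.loop w).val n) : HasPartialCycle Q {w} ∅ := by
  refine ⟨∅, 0, ⟨(w, 0), (List.range (n - 1)).map fun s => (w, 0 + (s + 1) • Γ.loop w), ?_⟩,
    by simp⟩
  rw [← fibreOrbit_eq_cons]
  have hn : n - 1 + 1 = n := Nat.sub_add_cancel (NeZero.pos n)
  refine ⟨nodup_fibreOrbit fun s hs s' hs' h => ?_, isChain_fibreOrbit (fun s _ => ?_) ?_,
    fun y => ?_⟩
  · exact nsmul_left_inj_of_coprime hr (by omega) (by omega) (add_left_cancel h)
  · rw [add_nsmul, one_nsmul, ← add_assoc]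
    exact stepRel_loop hw _ _
  · have := stepRel_loop hw ∅ (0 + (n - 1) • Γ.loop w)
    rwa [add_assoc, ← succ_nsmul, hn, nsmul_eq_mul n, ZMod.natCast_self, zero_mul, add_zero] at this
  · rw [mem_fibreOrbit]
    constructor
    · rintro ⟨s, -, rfl⟩
      rfl
    · obtain ⟨w', y⟩ := y
      intro hw'
      obtain rfl : w' = w := hw'
      obtain ⟨s, hs, rfl⟩ := exists_lt_eq_nsmul_of_coprime hr y
      exact ⟨s, by omega, by simp⟩

end Insertion

/-! ### Growing the cycle along the tree. -/

section Growth

variable (Q)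

/-- `C` is the vertex set of the connected subgraph formed by `root` and the paths `Q_i` with
`i ∈ P`, and the fibres over `C` have a suitable cyclic arrangement. -/
structure IsGrown (root : V) (C : Set V) (P : Set (Fin k)) : Prop where
  eq_root_or_mem : ∀ w ∈ C, w = root ∨ ∃ i ∈ P, w ∈ (Q i).1.support
  support_subset : ∀ i ∈ P, ∀ w ∈ (Q i).1.support, w ∈ C
  root_mem : root ∈ C
  exists_walk : ∀ w ∈ C, ∃ p : Γ.graph.Walk root w, ∀ e ∈ p.edges, ∃ i ∈ P, e ∈ (Q i).1.edges
  hasPartialCycle : HasPartialCycle Q C P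

variable {Q} {root : V} {C : Set V} {P : Set (Fin k)} {i₀ j : Fin k}

theorem IsGrown.endpoint_of_mem (h : IsGrown Q root C P) (hQ : Γ.IsOddShiftingDecomposition Q)
    (hroot : root = src i₀) (hj : j ∉ P) {w : V} (hw : w ∈ (Q j).1.support) (hwC : w ∈ C) :
    w = src j ∨ w = tgt j := by
  rcases h.eq_root_or_mem w hwC with rfl | ⟨i, hi, hwi⟩
  · by_cases hji : j = i₀
    · exact Or.inl (hji ▸ hroot)
    · exact (hQ.disjoint j i₀ hji w hw (hroot ▸ (Q i₀).1.start_mem_support)).1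
  · exact (hQ.disjoint j i (fun h => hj (h ▸ hi)) w hw hwi).1

/-- Otherwise the ends of `Q_j` would be joined by a path made of edges of other `Q_i`. In a tree
that path is `Q_j` itself, contradicting the edge partition. -/
theorem IsGrown.not_both_mem (h : IsGrown Q root C P) (hQ : Γ.IsOddShiftingDecomposition Q)
    (hT : Γ.graph.IsTree) (hj : j ∉ P) : ¬ (src j ∈ C ∧ tgt j ∈ C) := by
  rintro ⟨h1, h2⟩
  obtain ⟨p, hp⟩ := h.exists_walk _ h1
  obtain ⟨q, hq⟩ := h.exists_walk _ h2
  have hpq : ∀ e ∈ (p.reverse.append q).edges, ∃ i ∈ P, e ∈ (Q i).1.edges := by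
    intro e he
    rw [SimpleGraph.Walk.edges_append, SimpleGraph.Walk.edges_reverse, List.mem_append,
      List.mem_reverse] at he
    exact he.elim (hp e) (hq e)
  have heq : Q j = (p.reverse.append q).toPath := (hT.isAcyclic.subsingleton_path _ _).elim _ _
  have hL := (hQ.oddShifting j).two_le_length
  obtain ⟨e, he⟩ : ∃ e, e ∈ (Q j).1.edges := by
    refine List.exists_mem_of_length_pos ?_
    rw [SimpleGraph.Walk.length_edges]
    omega
  have he' : e ∈ (p.reverse.append q).toPath.1.edges := heq ▸ he
  obtain ⟨i, hi, hei⟩ := hpq e (SimpleGraph.Walk.edges_bypass_subset_edges _ he')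
  have := (hQ.partition e ((Q j).1.edges_subset_edgeSet he)).unique he hei
  exact hj (this ▸ hi)

variable [NeZero n]

theorem IsGrown.insert (h : IsGrown Q root C P) (hQ : Γ.IsOddShiftingDecomposition Q)
    (hweight : Γ.IsProperlyWeighted Q) (hroot : root = src i₀) (hj : j ∉ P) {u v : V}
    (hu : u = src j ∨ u = tgt j) (hv : v = src j ∨ v = tgt j)
    (hbridge : Γ.IsBridge u v {w | w ∈ (Q j).1.support ∧ w ≠ src j ∧ w ≠ tgt j}
      (2 * Γ.pathC (Q j).1))
    (hr : Nat.Coprime (Γ.loop u).val n) (huv : Γ.loop u = Γ.loop v) (huC : u ∈ C) (hvC : v ∉ C)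
    (hsupp : ∀ w, w ∈ (Q j).1.support ↔
      (w ∈ (Q j).1.support ∧ w ≠ src j ∧ w ≠ tgt j) ∨ w = u ∨ w = v)
    (q : Γ.graph.Walk u v) (hqs : ∀ w ∈ (Q j).1.support, w ∈ q.support)
    (hqe : ∀ e ∈ q.edges, e ∈ (Q j).1.edges) :
    IsGrown Q root
      (C ∪ {w | w ∈ {w | w ∈ (Q j).1.support ∧ w ≠ src j ∧ w ≠ tgt j} ∨ w = v})
      (Insert.insert j P) where
  eq_root_or_mem := by
    rintro w (hw | hw)
    · rcases h.eq_root_or_mem w hw with h | ⟨i, hi, hw⟩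
      · exact Or.inl h
      · exact Or.inr ⟨i, Or.inr hi, hw⟩
    · exact Or.inr ⟨j, Or.inl rfl, (hsupp w).2 (hw.imp_right Or.inr)⟩
  support_subset := by
    rintro i (rfl | hi) w hw
    · rcases (hsupp w).1 hw with h | rfl | h
      · exact Or.inr (Or.inl h)
      · exact Or.inl huC
      · exact Or.inr (Or.inr h)
    · exact Or.inl (h.support_subset i hi w hw)
  root_mem := Or.inl h.root_mem
  exists_walk := by
    rintro w (hw | hw)
    · obtain ⟨p, hp⟩ := h.exists_walk w hw
      exact ⟨p, fun e he => (hp e he).imp fun _ h => ⟨Or.inr h.1, h.2⟩⟩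
    · obtain ⟨p, hp⟩ := h.exists_walk u huC
      have hwq : w ∈ q.support := hqs w ((hsupp w).2 (hw.imp_right Or.inr))
      refine ⟨p.append (q.takeUntil w hwq), fun e he => ?_⟩
      rw [SimpleGraph.Walk.edges_append, List.mem_append] at he
      rcases he with he | he
      · exact (hp e he).imp fun _ h => ⟨Or.inr h.1, h.2⟩
      · exact ⟨j, Or.inl rfl, hqe e (q.edges_takeUntil_subset_edges hwq he)⟩
  hasPartialCycle := by
    refine h.hasPartialCycle.insert hweight hj hu hv hbridge hr huv huC hvC ?_ ?_ ?_
    · rintro ⟨-, h1, h2⟩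
      exact hv.elim h1 h2
    · rintro w ⟨hw, h1, h2⟩ hwC
      exact (h.endpoint_of_mem hQ hroot hj hw hwC).elim h1 h2
    · rintro w ⟨hw, h1, h2⟩ i hwi
      by_cases hij : i = j
      · subst hij
        exact hwi.elim h1 h2
      · refine (hQ.disjoint j i (Ne.symm hij) w hw ?_).1.elim h1 h2
        rcases hwi with rfl | rfl
        · exact (Q i).1.start_mem_support
        · exact (Q i).1.end_mem_support

/-- A walk from the root to a missing vertex leaves `C` through an edge of some `Q_j` not yet used.
This `Q_j` meets `C` only at its ends, and in exactly one of them, so it can be attached there. -/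
theorem IsGrown.exists_larger (h : IsGrown Q root C P) (hQ : Γ.IsOddShiftingDecomposition Q)
    (hT : Γ.graph.IsTree) (hcoprime : ∀ i, Nat.Coprime (Γ.loop (src i)).val n)
    (hweight : Γ.IsProperlyWeighted Q) (hroot : root = src i₀) (hC : C ≠ Set.univ) :
    ∃ C' P', C ⊂ C' ∧ IsGrown Q root C' P' := by
  obtain ⟨y, hy⟩ := (Set.ne_univ_iff_exists_notMem C).1 hC
  obtain ⟨p⟩ := hT.connected.preconnected root y
  obtain ⟨e, -, hx, hy'⟩ := p.exists_boundary_dart C h.root_mem hy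
  obtain ⟨j, hej, -⟩ := hQ.partition e.edge e.edge_mem
  have hxs := (Q j).1.fst_mem_support_of_mem_edges hej
  have hys := (Q j).1.snd_mem_support_of_mem_edges hej
  have hj : j ∉ P := fun hj => hy' (h.support_subset j hj _ hys)
  have hboth := h.not_both_mem hQ hT hj
  have hodd := hQ.oddShifting j
  have hbridge := hodd.isBridge (Q j).2 (hcoprime j)
  have hloop := hodd.1
  have hsub : ∀ (A : Set V) {v : V}, v ∉ C → C ⊂ C ∪ {w | w ∈ A ∨ w = v} := fun A v hv =>
    (Set.ssubset_iff_of_subset Set.subset_union_left).2 ⟨v, Or.inr (Or.inr rfl), hv⟩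
  have hss := (Q j).1.start_mem_support
  have hts := (Q j).1.end_mem_support
  have hsupp : ∀ w, w ∈ (Q j).1.support ↔
      (w ∈ (Q j).1.support ∧ w ≠ src j ∧ w ≠ tgt j) ∨ w = src j ∨ w = tgt j := by
    intro w
    constructor
    · intro hw
      tauto
    · rintro (h | rfl | rfl)
      · exact h.1
      · exact hss
      · exact hts
  rcases h.endpoint_of_mem hQ hroot hj hxs hx with hxe | hxe
  · have hsC : src j ∈ C := hxe ▸ hx
    have htC : tgt j ∉ C := fun ht => hboth ⟨hsC, ht⟩
    exact ⟨_, _, hsub _ htC, h.insert hQ hweight hroot hj (Or.inl rfl) (Or.inr rfl) hbridge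
      (hcoprime j) hloop hsC htC hsupp (Q j).1 (fun _ h => h) (fun _ h => h)⟩
  · have htC : tgt j ∈ C := hxe ▸ hx
    have hsC : src j ∉ C := fun hs => hboth ⟨hs, htC⟩
    exact ⟨_, _, hsub _ hsC, h.insert hQ hweight hroot hj (Or.inr rfl) (Or.inl rfl)
      (hbridge.symm hloop (even_two_mul _)) (hloop ▸ hcoprime j) hloop.symm htC hsC
      (fun w => (hsupp w).trans (or_congr_right or_comm)) (Q j).1.reverse
      (fun _ h => by simpa using h) (fun _ h => by simpa using h)⟩

theorem IsGrown.exists_univ [Finite V] (hQ : Γ.IsOddShiftingDecomposition Q)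
    (hT : Γ.graph.IsTree) (hcoprime : ∀ i, Nat.Coprime (Γ.loop (src i)).val n)
    (hweight : Γ.IsProperlyWeighted Q) (hroot : root = src i₀) :
    ∀ (C : Set V) (P : Set (Fin k)), IsGrown Q root C P → ∃ P', IsGrown Q root Set.univ P' := by
  intro C
  induction C using WellFoundedGT.induction with
  | ind C ih =>
    intro P h
    by_cases hC : C = Set.univ
    · exact ⟨P, hC ▸ h⟩
    · obtain ⟨C', P', hlt, h'⟩ := h.exists_larger hQ hT hcoprime hweight hroot hC
      exact ih C' hlt P' h'

end Growth

end ReflexiveVoltageGraph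

theorem mainTheorem6 {V : Type*} [Fintype V] [DecidableEq V] {n : ℕ} [NeZero n]
    (T : ReflexiveVoltageGraph V n) (hT : T.graph.IsTree)
    {k : ℕ} (hk : 1 ≤ k) {src tgt : Fin k → V}
    (Q : ∀ i, T.graph.Path (src i) (tgt i))
    (hQ : T.IsOddShiftingDecomposition Q)
    (hcoprime : ∀ i, Nat.Coprime (T.loop (src i)).val n)
    (hweight : T.IsProperlyWeighted Q) :
    T.cover.IsHamiltonian := by
  let i₀ : Fin k := ⟨0, hk⟩
  have hodd := hQ.oddShifting i₀
  have hL := hodd.two_le_length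
  have hV : 1 < Fintype.card V := Fintype.one_lt_card_iff.2
    ⟨_, _, ((Q i₀).1.adj_getVert_succ (i := 0) (by omega)).ne⟩
  have hn : 2 ≤ n := by
    have h1 := hodd.two_mul_pathC_le
    obtain ⟨-, -, s, -, h2, h3, -⟩ := hodd
    omega
  have hloop : T.loop (src i₀) ≠ 0 := by
    intro h0
    have := nsmul_left_inj_of_coprime (hcoprime i₀) (i := 0) (j := 1) (by omega) (by omega)
      (by simp [h0])
    omega
  have hbase : ReflexiveVoltageGraph.IsGrown Q (src i₀) {src i₀} ∅ :=
    { eq_root_or_mem := fun w hw => Or.inl hw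
      support_subset := fun i hi => hi.elim
      root_mem := rfl
      exists_walk := by
        rintro w rfl
        exact ⟨SimpleGraph.Walk.nil, by simp⟩
      hasPartialCycle := ReflexiveVoltageGraph.hasPartialCycle_singleton hloop (hcoprime i₀) }
  obtain ⟨P, hP⟩ := ReflexiveVoltageGraph.IsGrown.exists_univ hQ hT hcoprime hweight rfl _ _ hbase
  obtain ⟨K, o, hcyc, -⟩ := hP.hasPartialCycle
  refine SimpleGraph.isHamiltonian_of_cyclicOn ?_ ?_
  · rw [Fintype.card_prod, ZMod.card]
    nlinarith
  · have : {x : V × ZMod n | x.1 ∈ (Set.univ : Set V)} = Set.univ := by ext; simp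
    rw [← this]
    exact hcyc.mono fun _ _ h => h.1
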